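/- Let $I_\nu$ and $K_\nu$ denote the modified Bessel functions of the first and of the second kind of real order $\nu$; for $x>0$, $$I_\nu(x)=\sum_{k=0}^{\infty}\frac{(x/2)^{2k+\nu}}{k!\,\Gamma(k+\nu+1)},\qquad K_\nu(x)=\int_0^\infty e^{-x\cosh t}\cosh(\nu t)\,dt .$$ If $x>0$ and $\nu\ge\frac12$, then $$I_\nu(x)K_\nu(x)-\frac{1}{2x}<\frac{1}{16x^2}.$$ -/

import Mathlib

/-- The modified Bessel function of the first kind `I_ν(x)` of real order `ν` at `x > 0`, by its
power series `∑ (x/2)^(2k+ν) / (k! Γ(k+ν+1))`. Where `k+ν+1` is a pole of `Γ` the term is `0`,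
in accordance with the usual convention `1/Γ = 0` there. -/
noncomputable def besselI (ν x : ℝ) : ℝ :=
  ∑' k : ℕ, (x / 2) ^ (2 * (k : ℝ) + ν) / ((k.factorial : ℝ) * Real.Gamma ((k : ℝ) + ν + 1))

/-- The modified Bessel function of the second kind (Macdonald function) `K_ν(x)` of real order `ν`
at `x > 0`, by the absolutely convergent integral `∫₀^∞ exp(-x cosh t) cosh(ν t) dt`, which covers
integer and non-integer orders alike. -/
noncomputable def besselK (ν x : ℝ) : ℝ :=
  ∫ t in Set.Ioi (0 : ℝ), Real.exp (-x * Real.cosh t) * Real.cosh (ν * t)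

open Real Set Filter Topology MeasureTheory

/-! ### The modified Bessel function of the second kind -/

/-! The stronger bound $I_\nu K_\nu \le 1/(2x)$ holds, and the positive right-hand side then gives
strictness. The Wronskian $x(I_\nu K_{\nu+1} + I_{\nu+1}K_\nu)$ is constant and at most 1 by its
behaviour at $0^+$ (`besselI_besselK_wronskian_le`). Put $r = (\nu+1/2)/x$. If $I_{\nu+1} \ge
(1-r)I_\nu$ and $K_{\nu+1} \ge (1+r)K_\nu$, the terms in $r$ cancel and $2xI_\nu K_\nu \le 1$. These
bounds say $u' \ge u$ for $u = \sqrt{x}I_\nu$ and $v' \le -v$ for $v = \sqrt{x}K_\nu$. Both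
functions solve $w'' = (1 + (\nu^2-1/4)/x^2)w$, so for $\nu \ge 1/2$ both $e^x(u'-u)$ and
$e^{-x}(v'+v)$ increase. The first is nonnegative near 0, the second tends to 0 at infinity. -/

lemma integral_exp_mul_sub_exp {μ a : ℝ} (hμ : 0 < μ) (ha : 0 < a) :
    Integrable (fun t : ℝ => exp (μ * t - a * exp t)) ∧
      ∫ t : ℝ, exp (μ * t - a * exp t) = (1 / a) ^ μ * Gamma μ := by
  have h := Real.integral_rpow_mul_exp_neg_mul_Ioi hμ ha
  have hpos : 0 < (1 / a) ^ μ * Gamma μ := by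
    have := Gamma_pos_of_pos hμ
    positivity
  have hint : IntegrableOn (fun t : ℝ => t ^ (μ - 1) * exp (-(a * t))) (Ioi 0) := by
    -- A non-integrable function would have integral 0 by convention, but the Gamma value is
    -- positive.
    by_contra hc
    rw [integral_undef hc] at h
    exact hpos.ne h
  have himg : exp '' univ = Ioi (0 : ℝ) := by rw [image_univ, range_exp]
  have hd : ∀ t ∈ (univ : Set ℝ), HasDerivWithinAt exp (exp t) univ t :=
    fun t _ => (hasDerivAt_exp t).hasDerivWithinAt
  have hfun : (fun t : ℝ => |exp t| • (exp t ^ (μ - 1) * exp (-(a * exp t)))) =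
      fun t => exp (μ * t - a * exp t) := by
    funext t
    rw [abs_of_pos (exp_pos t), ← exp_mul, smul_eq_mul, ← exp_add, ← exp_add]
    congr 1
    ring
  constructor
  · rw [← himg, integrableOn_image_iff_integrableOn_abs_deriv_smul MeasurableSet.univ hd
      exp_injective.injOn, hfun, integrableOn_univ] at hint
    exact hint
  · rw [← himg, integral_image_eq_integral_abs_deriv_smul MeasurableSet.univ hd
      exp_injective.injOn, hfun, setIntegral_univ] at h
    exact h

/-- Each exponential half of $\cosh(\mu t)$ keeps only one half of $\cosh t$ in the exponent. The
two resulting terms are reflections of each other, so their half-line integrals join into one Gamma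
integral over the whole line. -/
lemma exp_neg_mul_cosh_mul_cosh_le {x : ℝ} (hx : 0 < x) (μ t : ℝ) :
    exp (-x * cosh t) * cosh (μ * t) ≤
      (exp (μ * t - x / 2 * exp t) + exp (μ * (-t) - x / 2 * exp (-t))) / 2 := by
  have h1 : exp (-x * cosh t) * exp (μ * t) ≤ exp (μ * t - x / 2 * exp t) := by
    rw [← exp_add, exp_le_exp, cosh_eq]
    nlinarith [mul_pos hx (exp_pos (-t))]
  have h2 : exp (-x * cosh t) * exp (-(μ * t)) ≤ exp (μ * (-t) - x / 2 * exp (-t)) := by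
    rw [← exp_add, exp_le_exp, cosh_eq]
    nlinarith [mul_pos hx (exp_pos t)]
  rw [cosh_eq (μ * t)]
  linarith

lemma integrableOn_besselK (ν : ℝ) {x : ℝ} (hx : 0 < x) :
    IntegrableOn (fun t : ℝ => exp (-x * cosh t) * cosh (ν * t)) (Ioi 0) := by
  -- Raising the order to $|\nu|+1$ makes the Gamma integral converge for every real $\nu$.
  have hμ : 0 < |ν| + 1 := by positivity
  have h := (integral_exp_mul_sub_exp hμ (half_pos hx)).1
  refine Integrable.mono' ((h.add h.comp_neg).div_const 2).integrableOn
    (by fun_prop) (Eventually.of_forall fun t => ?_)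
  rw [norm_of_nonneg (by positivity)]
  refine le_trans ?_ (exp_neg_mul_cosh_mul_cosh_le hx (|ν| + 1) t)
  gcongr
  rw [cosh_le_cosh, abs_mul, abs_mul, abs_of_pos hμ]
  gcongr
  linarith

lemma besselK_nonneg (ν x : ℝ) : 0 ≤ besselK ν x :=
  integral_nonneg fun t => by positivity

lemma besselK_le {μ x : ℝ} (hμ : 0 < μ) (hx : 0 < x) :
    besselK μ x ≤ (2 / x) ^ μ * Gamma μ / 2 := by
  obtain ⟨h, h'⟩ := integral_exp_mul_sub_exp hμ (half_pos hx)
  have hle : besselK μ x ≤ ∫ t in Ioi (0 : ℝ),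
      (exp (μ * t - x / 2 * exp t) + exp (μ * (-t) - x / 2 * exp (-t))) / 2 :=
    setIntegral_mono (integrableOn_besselK μ hx) ((h.add h.comp_neg).div_const 2).integrableOn
      (exp_neg_mul_cosh_mul_cosh_le hx μ)
  refine hle.trans_eq ?_
  rw [integral_div, integral_add h.integrableOn h.comp_neg.integrableOn,
    integral_comp_neg_Ioi (f := fun t => exp (μ * t - x / 2 * exp t)), neg_zero, add_comm,
    intervalIntegral.integral_Iic_add_Ioi h.integrableOn h.integrableOn, h', one_div_div]

lemma besselK_anti (ν : ℝ) {x y : ℝ} (hx : 0 < x) (hxy : x ≤ y) :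
    besselK ν y ≤ besselK ν x := by
  refine setIntegral_mono (integrableOn_besselK ν (hx.trans_le hxy))
    (integrableOn_besselK ν hx) fun t => ?_
  have := cosh_pos t
  dsimp only
  gcongr

lemma cosh_mul_cosh_mul (ν t : ℝ) :
    cosh t * cosh (ν * t) = (cosh ((ν + 1) * t) + cosh ((ν - 1) * t)) / 2 := by
  rw [add_one_mul, sub_one_mul, cosh_add, cosh_sub]
  ring

lemma sinh_mul_sinh_mul (ν t : ℝ) :
    sinh t * sinh (ν * t) = (cosh ((ν + 1) * t) - cosh ((ν - 1) * t)) / 2 := by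
  rw [add_one_mul, sub_one_mul, cosh_add, cosh_sub]
  ring

lemma hasDerivAt_besselK_half (ν : ℝ) {x : ℝ} (hx : 0 < x) :
    HasDerivAt (besselK ν) (-(besselK (ν + 1) x + besselK (ν - 1) x) / 2) x := by
  have key := (hasDerivAt_integral_of_dominated_loc_of_deriv_le (μ := volume.restrict (Ioi 0))
    (F := fun y t : ℝ => exp (-y * cosh t) * cosh (ν * t))
    (F' := fun y t : ℝ => -((exp (-y * cosh t) * cosh ((ν + 1) * t) +
      exp (-y * cosh t) * cosh ((ν - 1) * t)) / 2))
    -- For $y > x/2$ the integrand is dominated by its value at $x/2$.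
    (bound := fun t : ℝ => (exp (-(x / 2) * cosh t) * cosh ((ν + 1) * t) +
      exp (-(x / 2) * cosh t) * cosh ((ν - 1) * t)) / 2)
    (Ioi_mem_nhds (half_lt_self hx))
    (Eventually.of_forall fun y => by fun_prop)
    (integrableOn_besselK ν hx) (by fun_prop)
    (Eventually.of_forall fun t y hy => ?_)
    (((integrableOn_besselK _ (half_pos hx)).add
      (integrableOn_besselK _ (half_pos hx))).div_const 2)
    (Eventually.of_forall fun t y hy => ?_)).2
  · convert! key using 1
    rw [integral_neg, integral_div,
      integral_add (integrableOn_besselK _ hx) (integrableOn_besselK _ hx), neg_div]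
    rfl
  · have hy' : x / 2 ≤ y := le_of_lt hy
    have := cosh_pos t
    rw [norm_neg, norm_of_nonneg (by positivity)]
    gcongr
  · have h := ((((hasDerivAt_id y).neg.mul_const (cosh t)).exp).mul_const (cosh (ν * t)))
    convert! h using 1
    simp only [Pi.neg_apply, id]
    linear_combination exp (-y * cosh t) * cosh_mul_cosh_mul ν t

/-- Integrate the derivative of $e^{-x\cosh t}\sinh(\nu t)$ over the half-line; both boundary terms
vanish. -/
lemma besselK_add_one_sub (ν : ℝ) {x : ℝ} (hx : 0 < x) :
    x * (besselK (ν + 1) x - besselK (ν - 1) x) = 2 * ν * besselK ν x := by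
  have i0 := integrableOn_besselK ν hx
  have i1 := integrableOn_besselK (ν + 1) hx
  have i2 := integrableOn_besselK (ν - 1) hx
  have hd : ∀ t : ℝ, HasDerivAt (fun t => exp (-x * cosh t) * sinh (ν * t))
      (ν * (exp (-x * cosh t) * cosh (ν * t)) -
        x / 2 * (exp (-x * cosh t) * cosh ((ν + 1) * t) -
          exp (-x * cosh t) * cosh ((ν - 1) * t))) t := by
    intro t
    have h := (((hasDerivAt_cosh t).const_mul (-x)).exp).mul
      (((hasDerivAt_id t).const_mul ν).sinh)
    convert! h using 1
    simp only [id]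
    linear_combination (x * exp (-x * cosh t)) * sinh_mul_sinh_mul ν t
  have hint : IntegrableOn (fun t => exp (-x * cosh t) * sinh (ν * t)) (Ioi 0) := by
    refine Integrable.mono' i0 (by fun_prop) (Eventually.of_forall fun t => ?_)
    rw [norm_mul, norm_of_nonneg (exp_pos _).le]
    gcongr
    rw [norm_eq_abs, abs_sinh, ← cosh_abs]
    exact (sinh_lt_cosh _).le
  have i12 : IntegrableOn (fun t : ℝ => exp (-x * cosh t) * cosh ((ν + 1) * t) -
      exp (-x * cosh t) * cosh ((ν - 1) * t)) (Ioi 0) := i1.sub i2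
  have hint' := (i0.const_mul ν).sub (i12.const_mul (x / 2))
  have hlim := tendsto_zero_of_hasDerivAt_of_integrableOn_Ioi (fun t _ => hd t) hint' hint
  have h := integral_Ioi_of_hasDerivAt_of_tendsto' (a := 0) (fun t _ => hd t) hint' hlim
  rw [integral_sub (i0.const_mul ν) (i12.const_mul (x / 2)), integral_const_mul,
    integral_const_mul, integral_sub i1 i2] at h
  simp only [mul_zero, sinh_zero, sub_zero] at h
  change ν * besselK ν x - x / 2 * (besselK (ν + 1) x - besselK (ν - 1) x) = 0 at h
  linarith

lemma hasDerivAt_besselK (ν : ℝ) {x : ℝ} (hx : 0 < x) :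
    HasDerivAt (besselK ν) (ν / x * besselK ν x - besselK (ν + 1) x) x := by
  convert! hasDerivAt_besselK_half ν hx using 1
  have := besselK_add_one_sub ν hx
  field_simp
  linarith

lemma hasDerivAt_besselK_add_one (ν : ℝ) {x : ℝ} (hx : 0 < x) :
    HasDerivAt (besselK (ν + 1)) (-besselK ν x - (ν + 1) / x * besselK (ν + 1) x) x := by
  convert! hasDerivAt_besselK_half (ν + 1) hx using 1
  have := besselK_add_one_sub (ν + 1) hx
  rw [add_sub_cancel_right] at *
  field_simp
  linarith

/-! ### The modified Bessel function of the first kind -/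

/-- The coefficients of the entire part `∑ zᵏ / (k! Γ(k + ν + 1))` of `I_ν`. -/
noncomputable def besselICoeff (ν : ℝ) (k : ℕ) : ℝ :=
  1 / ((k.factorial : ℝ) * Gamma ((k : ℝ) + ν + 1))

/-- The entire part `∑ zᵏ / (k! Γ(k + ν + 1))` of `I_ν`, in the variable `z = x² / 4`. -/
noncomputable def besselIEntire (ν z : ℝ) : ℝ := ∑' k : ℕ, besselICoeff ν k * z ^ k

lemma besselICoeff_pos {ν : ℝ} (hν : 0 ≤ ν) (k : ℕ) : 0 < besselICoeff ν k := by
  have : 0 < Gamma ((k : ℝ) + ν + 1) := Gamma_pos_of_pos (by positivity)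
  unfold besselICoeff
  positivity

lemma besselICoeff_succ {ν : ℝ} (k : ℕ) :
    ((k : ℝ) + 1) * besselICoeff ν (k + 1) = besselICoeff (ν + 1) k := by
  unfold besselICoeff
  have h : ((k + 1 : ℕ) : ℝ) + ν + 1 = (k : ℝ) + (ν + 1) + 1 := by push_cast; ring
  rw [h, Nat.factorial_succ, Nat.cast_mul, Nat.cast_succ, mul_assoc, one_div, mul_inv, ← mul_assoc,
    mul_inv_cancel₀ (by positivity), one_mul, one_div]

lemma besselICoeff_eq {ν : ℝ} (hν : 0 ≤ ν) (k : ℕ) :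
    besselICoeff ν k = ((k : ℝ) + ν + 1) * besselICoeff (ν + 1) k := by
  unfold besselICoeff
  have hp : 0 < (k : ℝ) + ν + 1 := by positivity
  have hG := (Gamma_pos_of_pos hp).ne'
  rw [show (k : ℝ) + (ν + 1) + 1 = ((k : ℝ) + ν + 1) + 1 by ring, Gamma_add_one hp.ne']
  have := hp.ne'
  field_simp

lemma besselICoeff_le {ν : ℝ} (hν : 0 ≤ ν) (k : ℕ) :
    besselICoeff ν k ≤ 1 / Gamma (ν + 1) * (1 / (k.factorial : ℝ)) := by
  have hG : 0 < Gamma (ν + 1) := Gamma_pos_of_pos (by positivity)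
  -- $\Gamma$ is not monotone on $(1,2)$, but a unit step from $s \ge 1$ multiplies it by $s$.
  have h : Gamma (ν + 1) ≤ Gamma ((k : ℝ) + ν + 1) := by
    induction k with
    | zero => simp
    | succ k ih =>
      have hp : 0 < (k : ℝ) + ν + 1 := by positivity
      rw [show ((k + 1 : ℕ) : ℝ) + ν + 1 = ((k : ℝ) + ν + 1) + 1 by push_cast; ring,
        Gamma_add_one hp.ne']
      refine ih.trans (le_mul_of_one_le_left (Gamma_pos_of_pos hp).le ?_)
      linarith [(k.cast_nonneg : (0 : ℝ) ≤ k)]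
  unfold besselICoeff
  rw [one_div_mul_one_div, mul_comm (Gamma (ν + 1))]
  gcongr

lemma hasSum_exp_const (C r : ℝ) :
    HasSum (fun k : ℕ => C * (1 / (k.factorial : ℝ)) * r ^ k) (C * exp r) := by
  have h := (NormedSpace.expSeries_div_hasSum_exp (𝔸 := ℝ) r).mul_left C
  rw [← exp_eq_exp_ℝ] at h
  convert! h using 2
  ring

lemma summable_besselICoeff_mul_pow {ν : ℝ} (hν : 0 ≤ ν) (z : ℝ) :
    Summable fun k : ℕ => besselICoeff ν k * z ^ k := by
  refine Summable.of_norm_bounded (hasSum_exp_const (1 / Gamma (ν + 1)) |z|).summable fun k => ?_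
  rw [norm_mul, norm_pow, norm_of_nonneg (besselICoeff_pos hν k).le, norm_eq_abs]
  gcongr
  exact besselICoeff_le hν k

lemma besselIEntire_le {ν z : ℝ} (hν : 0 ≤ ν) (hz : 0 ≤ z) :
    besselIEntire ν z ≤ 1 / Gamma (ν + 1) * exp z := by
  rw [← (hasSum_exp_const (1 / Gamma (ν + 1)) z).tsum_eq]
  refine (summable_besselICoeff_mul_pow hν z).tsum_le_tsum (fun k => ?_)
    (hasSum_exp_const (1 / Gamma (ν + 1)) z).summable
  gcongr
  exact besselICoeff_le hν k

lemma besselIEntire_nonneg {ν z : ℝ} (hν : 0 ≤ ν) (hz : 0 ≤ z) : 0 ≤ besselIEntire ν z :=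
  tsum_nonneg fun k => mul_nonneg (besselICoeff_pos hν k).le (pow_nonneg hz k)

lemma hasDerivAt_besselIEntire {ν : ℝ} (hν : 0 ≤ ν) (z : ℝ) :
    HasDerivAt (besselIEntire ν) (besselIEntire (ν + 1) z) z := by
  have hν' : 0 ≤ ν + 1 := by positivity
  have h := hasDerivAt_tsum_of_isPreconnected (t := Metric.ball (0 : ℝ) (|z| + 1))
    (g := fun (k : ℕ) w => besselICoeff ν k * w ^ k)
    (g' := fun (k : ℕ) w => besselICoeff ν k * (k * w ^ (k - 1)))
    (u := fun k : ℕ => besselICoeff ν k * (k * (|z| + 1) ^ (k - 1))) (y := z) (y₀ := 0)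
    ?_ Metric.isOpen_ball (convex_ball _ _).isPreconnected
    (fun k w _ => (hasDerivAt_pow k w).const_mul _) ?_ (by simp; positivity)
    (summable_besselICoeff_mul_pow hν 0) (by simp)
  · convert! h using 1
    have hs : Summable fun k : ℕ => besselICoeff ν k * (k * z ^ (k - 1)) := by
      rw [← summable_nat_add_iff 1]
      convert! summable_besselICoeff_mul_pow hν' z using 2 with k
      rw [← besselICoeff_succ, add_tsub_cancel_right]; push_cast; ring
    rw [hs.tsum_eq_zero_add]
    simp only [CharP.cast_eq_zero, zero_mul, mul_zero, zero_add]
    refine tsum_congr fun k => ?_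
    rw [← besselICoeff_succ, add_tsub_cancel_right]; push_cast; ring
  · rw [← summable_nat_add_iff 1]
    convert! summable_besselICoeff_mul_pow hν' (|z| + 1) using 2 with k
    rw [← besselICoeff_succ, add_tsub_cancel_right]; push_cast; ring
  · intro k w hw
    have hw' : |w| ≤ |z| + 1 := by simpa using (mem_ball_zero_iff.1 hw).le
    rw [norm_mul, norm_mul, norm_pow, norm_of_nonneg (besselICoeff_pos hν k).le,
      norm_of_nonneg (Nat.cast_nonneg k), norm_eq_abs]
    have := (besselICoeff_pos hν k).le
    gcongr

/-- Split the factor $k+\nu+1$ of `besselICoeff_eq` as $(\nu+1)+k$; the $k$ cancels into $k!$ and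
shifts the series to order $\nu+2$. -/
lemma besselIEntire_recurrence {ν : ℝ} (hν : 0 ≤ ν) (z : ℝ) :
    besselIEntire ν z = (ν + 1) * besselIEntire (ν + 1) z + z * besselIEntire (ν + 2) z := by
  have h1 := summable_besselICoeff_mul_pow (ν := ν + 1) (by positivity) z
  have h2 := summable_besselICoeff_mul_pow (ν := ν + 2) (by positivity) z
  have h3 : ∀ k : ℕ, ((k + 1 : ℕ) : ℝ) * (besselICoeff (ν + 1) (k + 1) * z ^ (k + 1)) =
      z * (besselICoeff (ν + 2) k * z ^ k) := by
    intro k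
    rw [show ν + 2 = ν + 1 + 1 by ring, ← besselICoeff_succ (ν := ν + 1)]; push_cast; ring
  have hs : Summable fun k : ℕ => (k : ℝ) * (besselICoeff (ν + 1) k * z ^ k) := by
    rw [← summable_nat_add_iff 1]
    exact (h2.mul_left z).congr fun k => (h3 k).symm
  have e : z * besselIEntire (ν + 2) z = ∑' k : ℕ, (k : ℝ) * (besselICoeff (ν + 1) k * z ^ k) := by
    rw [hs.tsum_eq_zero_add, tsum_congr h3, tsum_mul_left]
    simp [besselIEntire]
  rw [e, besselIEntire, besselIEntire, ← tsum_mul_left, ← (h1.mul_left (ν + 1)).tsum_add hs]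
  refine tsum_congr fun k => ?_
  rw [besselICoeff_eq hν]
  ring

lemma besselI_eq (ν : ℝ) {x : ℝ} (hx : 0 < x) :
    besselI ν x = (x / 2) ^ ν * besselIEntire ν (x ^ 2 / 4) := by
  rw [besselI, besselIEntire, ← tsum_mul_left]
  refine tsum_congr fun k => ?_
  rw [rpow_add (by positivity), mul_comm (2 : ℝ), rpow_mul (by positivity), rpow_natCast,
    besselICoeff, rpow_two, show x ^ 2 / 4 = (x / 2) ^ 2 by ring, ← pow_mul, ← pow_mul, mul_comm k 2]
  ring

lemma besselI_nonneg {ν x : ℝ} (hν : 0 ≤ ν) (hx : 0 < x) : 0 ≤ besselI ν x := by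
  rw [besselI_eq ν hx]
  have := besselIEntire_nonneg hν (z := x ^ 2 / 4) (by positivity)
  positivity

lemma besselI_le {ν x : ℝ} (hν : 0 ≤ ν) (hx : 0 < x) :
    besselI ν x ≤ (x / 2) ^ ν / Gamma (ν + 1) * exp (x ^ 2 / 4) := by
  rw [besselI_eq ν hx, div_mul_eq_mul_div, mul_div_assoc]
  have := besselIEntire_le hν (z := x ^ 2 / 4) (by positivity)
  rw [one_div_mul_eq_div] at this
  gcongr

lemma hasDerivAt_besselI {ν x : ℝ} (hν : 0 ≤ ν) (hx : 0 < x) :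
    HasDerivAt (besselI ν) (ν / x * besselI ν x + besselI (ν + 1) x) x := by
  have h2 : 0 < x / 2 := half_pos hx
  have hz : HasDerivAt (fun y : ℝ => y ^ 2 / 4) (x / 2) x := by
    convert! (hasDerivAt_pow 2 x).div_const 4 using 1
    norm_num; ring
  have hp : HasDerivAt (fun y : ℝ => (y / 2) ^ ν) (1 / 2 * ν * (x / 2) ^ (ν - 1)) x :=
    ((hasDerivAt_id x).div_const 2).rpow_const (Or.inl h2.ne')
  have h := hp.mul ((hasDerivAt_besselIEntire hν (x ^ 2 / 4)).comp x hz)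
  have heq : besselI ν =ᶠ[𝓝 x] fun y => (y / 2) ^ ν * besselIEntire ν (y ^ 2 / 4) := by
    filter_upwards [Ioi_mem_nhds hx] with y hy using besselI_eq ν hy
  refine HasDerivAt.congr_of_eventuallyEq ?_ heq
  convert! h using 1
  rw [besselI_eq ν hx, besselI_eq (ν + 1) hx, rpow_add_one h2.ne', rpow_sub_one h2.ne']
  simp only [Function.comp]
  field_simp

lemma besselI_recurrence {ν x : ℝ} (hν : 0 ≤ ν) (hx : 0 < x) :
    besselI ν x = 2 * (ν + 1) / x * besselI (ν + 1) x + besselI (ν + 2) x := by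
  have h2 : 0 < x / 2 := half_pos hx
  rw [besselI_eq ν hx, besselI_eq (ν + 1) hx, besselI_eq (ν + 2) hx,
    besselIEntire_recurrence hν, rpow_add_one h2.ne', rpow_add h2, rpow_two]
  field_simp
  ring

lemma hasDerivAt_besselI_add_one {ν x : ℝ} (hν : 0 ≤ ν) (hx : 0 < x) :
    HasDerivAt (besselI (ν + 1)) (besselI ν x - (ν + 1) / x * besselI (ν + 1) x) x := by
  convert! hasDerivAt_besselI (ν := ν + 1) (by positivity) hx using 1
  rw [besselI_recurrence hν hx, show ν + 1 + 1 = ν + 2 by ring]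
  ring

/-! ### Bounds for the product -/

lemma besselI_besselK_wronskian_const {ν x y : ℝ} (hν : 0 ≤ ν) (hx : 0 < x) (hy : 0 < y) :
    x * (besselI ν x * besselK (ν + 1) x + besselI (ν + 1) x * besselK ν x) =
      y * (besselI ν y * besselK (ν + 1) y + besselI (ν + 1) y * besselK ν y) := by
  have hd : ∀ z ∈ Ioi (0 : ℝ), HasDerivAt (fun z => z * (besselI ν z * besselK (ν + 1) z +
      besselI (ν + 1) z * besselK ν z)) 0 z := by
    intro z (hz : 0 < z)
    have h := (hasDerivAt_id z).mul (((hasDerivAt_besselI hν hz).mul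
      (hasDerivAt_besselK_add_one ν hz)).add ((hasDerivAt_besselI_add_one hν hz).mul
      (hasDerivAt_besselK ν hz)))
    convert! h using 1
    simp only [id, Pi.add_apply, Pi.mul_apply]
    field_simp
    ring
  refine (convex_Ioi (0 : ℝ)).is_const_of_fderivWithin_eq_zero (𝕜 := ℝ)
    (fun z hz => (hd z hz).differentiableAt.differentiableWithinAt) (fun z hz => ?_) hx hy
  rw [fderivWithin_of_isOpen isOpen_Ioi hz]
  ext
  simpa using (hd z hz).deriv

lemma besselI_besselK_wronskian_le {ν x : ℝ} (hν : 0 < ν) (hx : 0 < x) :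
    x * (besselI ν x * besselK (ν + 1) x + besselI (ν + 1) x * besselK ν x) ≤ 1 := by
  -- The small-argument bounds give $e^{y^2/4}$ for the first product and $c\,y^2e^{y^2/4}$ for the
  -- second.
  set c := Gamma ν / (4 * Gamma (ν + 1 + 1)) with hc
  have hlim : Tendsto (fun y : ℝ => exp (y ^ 2 / 4) * (1 + c * y ^ 2)) (𝓝[>] 0) (𝓝 1) := by
    have : Continuous fun y : ℝ => exp (y ^ 2 / 4) * (1 + c * y ^ 2) := by fun_prop
    simpa using (this.tendsto 0).mono_left nhdsWithin_le_nhds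
  refine ge_of_tendsto hlim ?_
  filter_upwards [self_mem_nhdsWithin] with y (hy : 0 < y)
  rw [besselI_besselK_wronskian_const hν.le hx hy]
  have hν' : 0 < ν + 1 := by positivity
  have hG := Gamma_pos_of_pos hν
  have hG1 := Gamma_pos_of_pos hν'
  have hG2 : 0 < Gamma (ν + 1 + 1) := Gamma_pos_of_pos (by positivity)
  have h1 := mul_le_mul (besselI_le hν.le hy) (besselK_le hν' hy) (besselK_nonneg _ _)
    (by positivity)
  have h2 := mul_le_mul (besselI_le hν'.le hy) (besselK_le hν hy) (besselK_nonneg _ _)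
    (by positivity)
  refine (mul_le_mul_of_nonneg_left (add_le_add h1 h2) hy.le).trans_eq ?_
  have hy2 : 0 < y / 2 := half_pos hy
  have hp := rpow_pos_of_pos hy2 ν
  rw [hc, show 2 / y = (y / 2)⁻¹ by rw [inv_div], rpow_add_one (inv_pos.2 hy2).ne',
    rpow_add_one hy2.ne', inv_rpow hy2.le]
  field_simp
  ring

lemma besselI_add_one_add_mul_besselI_nonneg {ν x : ℝ} (hν : 1 / 2 ≤ ν) (hx : 0 < x) :
    0 ≤ besselI (ν + 1) x + ((ν + 1 / 2) / x - 1) * besselI ν x := by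
  have hν0 : 0 ≤ ν := by linarith
  -- Up to $\nu+1/2$ both summands are nonnegative; monotonicity carries the sign further.
  have hsmall : ∀ y, 0 < y → y ≤ ν + 1 / 2 →
      0 ≤ besselI (ν + 1) y + ((ν + 1 / 2) / y - 1) * besselI ν y := by
    intro y hy hyν
    have h1 := besselI_nonneg (ν := ν + 1) (by positivity) hy
    have h2 := besselI_nonneg hν0 hy
    have h3 : 0 ≤ (ν + 1 / 2) / y - 1 := by rw [sub_nonneg, one_le_div hy]; exact hyν
    positivity
  rcases le_total x (ν + 1 / 2) with hle | hle
  · exact hsmall x hx hle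
  have hd : ∀ z ∈ Ioi (0 : ℝ), HasDerivAt (fun z => exp z * √z *
      (besselI (ν + 1) z + ((ν + 1 / 2) / z - 1) * besselI ν z))
      (exp z * √z * ((ν ^ 2 - 1 / 4) / z ^ 2 * besselI ν z)) z := by
    intro z (hz : 0 < z)
    have h := ((hasDerivAt_exp z).mul (hasDerivAt_sqrt hz.ne')).mul
      ((hasDerivAt_besselI_add_one hν0 hz).add
      ((((hasDerivAt_inv hz.ne').const_mul (ν + 1 / 2)).sub_const 1).mul
      (hasDerivAt_besselI hν0 hz)))
    convert! h using 1
    simp only [Pi.add_apply, Pi.mul_apply]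
    have hs : √z ≠ 0 := (sqrt_pos.2 hz).ne'
    field_simp
    rw [sq_sqrt hz.le]
    ring
  have hmono : MonotoneOn (fun z => exp z * √z *
      (besselI (ν + 1) z + ((ν + 1 / 2) / z - 1) * besselI ν z)) (Ioi 0) := by
    refine monotoneOn_of_deriv_nonneg (convex_Ioi 0)
      (fun z hz => (hd z hz).continuousAt.continuousWithinAt)
      (fun z hz => (hd z (interior_subset hz)).differentiableAt.differentiableWithinAt)
      fun z hz => ?_
    have hz' : 0 < z := interior_subset hz
    rw [(hd z hz').deriv]
    have h1 := besselI_nonneg hν0 hz'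
    have h2 : 0 ≤ ν ^ 2 - 1 / 4 := by nlinarith
    positivity
  have hpos : 0 < ν + 1 / 2 := by positivity
  have h := hmono hpos hx hle
  have h0 := hsmall _ hpos le_rfl
  exact nonneg_of_mul_nonneg_right (le_trans (by positivity) h)
    (mul_pos (exp_pos x) (sqrt_pos.2 hx))

lemma mul_besselK_le_besselK_add_one {ν x : ℝ} (hν : 1 / 2 ≤ ν) (hx : 0 < x) :
    (1 + (ν + 1 / 2) / x) * besselK ν x ≤ besselK (ν + 1) x := by
  have hd : ∀ z ∈ Ioi (0 : ℝ), HasDerivAt (fun z => exp (-z) * √z *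
      ((1 + (ν + 1 / 2) / z) * besselK ν z - besselK (ν + 1) z))
      (exp (-z) * √z * ((ν ^ 2 - 1 / 4) / z ^ 2 * besselK ν z)) z := by
    intro z (hz : 0 < z)
    have h := ((hasDerivAt_neg z).exp.mul (hasDerivAt_sqrt hz.ne')).mul
      (((((hasDerivAt_inv hz.ne').const_mul (ν + 1 / 2)).const_add 1).mul
      (hasDerivAt_besselK ν hz)).sub (hasDerivAt_besselK_add_one ν hz))
    convert! h using 1
    simp only [Pi.sub_apply, Pi.mul_apply]
    have hs : √z ≠ 0 := (sqrt_pos.2 hz).ne'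
    field_simp
    rw [sq_sqrt hz.le]
    ring
  have hmono : MonotoneOn (fun z => exp (-z) * √z *
      ((1 + (ν + 1 / 2) / z) * besselK ν z - besselK (ν + 1) z)) (Ioi 0) := by
    refine monotoneOn_of_deriv_nonneg (convex_Ioi 0)
      (fun z hz => (hd z hz).continuousAt.continuousWithinAt)
      (fun z hz => (hd z (interior_subset hz)).differentiableAt.differentiableWithinAt)
      fun z hz => ?_
    have hz' : 0 < z := interior_subset hz
    rw [(hd z hz').deriv]
    have h1 := besselK_nonneg ν z
    have h2 : 0 ≤ ν ^ 2 - 1 / 4 := by nlinarith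
    positivity
  have hlim : Tendsto (fun y : ℝ => y ^ (1 / 2 : ℝ) * exp (-1 * y) *
      ((1 + (ν + 1 / 2) / x) * besselK ν x)) atTop (𝓝 0) := by
    simpa using (tendsto_rpow_mul_exp_neg_mul_atTop_nhds_zero (1 / 2) 1 one_pos).mul_const
      ((1 + (ν + 1 / 2) / x) * besselK ν x)
  -- An increasing function with limit at most 0 is nonpositive. Dropping $-K_{\nu+1}(y)$ and
  -- freezing the rest at $x$ leaves a constant times $\sqrt{y}e^{-y}$.
  have h : exp (-x) * √x * ((1 + (ν + 1 / 2) / x) * besselK ν x - besselK (ν + 1) x) ≤ 0 := by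
    refine ge_of_tendsto hlim ?_
    filter_upwards [eventually_ge_atTop x] with y hy
    have hy0 : 0 < y := hx.trans_le hy
    refine (hmono hx hy0 hy).trans ?_
    dsimp only
    rw [← sqrt_eq_rpow, neg_one_mul, mul_comm (√y)]
    have h1 := besselK_nonneg ν y
    have h2 := besselK_nonneg (ν + 1) y
    have h3 := besselK_anti ν hx hy
    have h4 : (1 + (ν + 1 / 2) / y) * besselK ν y ≤ (1 + (ν + 1 / 2) / x) * besselK ν x := by
      gcongr
    gcongr
    linarith
  have := nonpos_of_mul_nonpos_right h (mul_pos (exp_pos (-x)) (sqrt_pos.2 hx))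
  linarith

/-- For `ν ≥ 1/2` the product `I_ν(x) K_ν(x)` never exceeds `1 / (2x)`. -/
lemma besselI_mul_besselK_le {ν x : ℝ} (hν : 1 / 2 ≤ ν) (hx : 0 < x) :
    besselI ν x * besselK ν x ≤ 1 / (2 * x) := by
  have hI := mul_nonneg (besselI_add_one_add_mul_besselI_nonneg hν hx) (besselK_nonneg ν x)
  have hK := mul_le_mul_of_nonneg_left (mul_besselK_le_besselK_add_one hν hx)
    (besselI_nonneg (by linarith : 0 ≤ ν) hx)
  have hW := besselI_besselK_wronskian_le (by linarith : 0 < ν) hx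
  have h : 2 * (besselI ν x * besselK ν x) ≤
      besselI ν x * besselK (ν + 1) x + besselI (ν + 1) x * besselK ν x := by
    linear_combination hI + hK
  rw [le_div_iff₀ (by positivity)]
  linarith [mul_le_mul_of_nonneg_left h hx.le]

theorem theorem4 (ν x : ℝ) (hν : 1 / 2 ≤ ν) (hx : 0 < x) :
    besselI ν x * besselK ν x - 1 / (2 * x) < 1 / (16 * x ^ 2) :=
  (sub_nonpos.2 (besselI_mul_besselK_le hν hx)).trans_lt (by positivity)
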